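/- Let $\mathcal E,\mathcal T$ be finite-dimensional Euclidean spaces and consider the problem $\min_{x\in\mathcal E} F(x)$ with $F=f+P$, $f,P:\mathcal E\to(-\infty,+\infty]$. Let $v^*=\inf_{x\in\mathcal E}F(x)$ and let $\mathcal X$ be the set of optimal solutions, i.e. of the points $x$ with $F(x)=v^*<+\infty$. Assume: (1a) $f(x)=h(\mathcal A(x))+\langle c,x\rangle$ for all $x$, where $\mathcal A:\mathcal E\to\mathcal T$ is linear, $c\in\mathcal E$, and $h:\mathcal T\to(-\infty,+\infty]$ is a convex function such that (i) its effective domain $\operatorname{dom}(h)=\{y: h(y)<+\infty\}$ is non-empty and open and $h$ is continuously differentiable on $\operatorname{dom}(h)$; (ii) for every compact convex set $V\subseteq\operatorname{dom}(h)$, $h$ is strongly convex on $V$ and $\nabla h$ is Lipschitz continuous on $V$ (with constants that may depend on $V$); (1b) $P$ is convex, closed (lower semicontinuous) and proper; (2) $\mathcal X$ is non-empty and compact; (3) $P$ is a polyhedral convex function, i.e. its epigraph $\{(x,t)\in\mathcal E\times\mathbb R: P(x)\le t\}$ is the intersection of finitely many closed half-spaces (the solution set of finitely many affine inequalities). Let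 $\operatorname{prox}_P(x)=\arg\min_{z\in\mathcal E}\{\tfrac12\|x-z\|_2^2+P(z)\}$ and, for $x$ with $f(x)<+\infty$, let $R(x)=\operatorname{prox}_P(x-\nabla f(x))-x$. Then the error bound with proximal map-based residual function holds: for every real $\zeta\ge v^*$ there exist constants $\kappa>0$ and $\epsilon>0$ such that $$ d(x,\mathcal X)\le\kappa\,\|R(x)\|_2\quad\text{for all } x\in\mathcal E \text{ with } F(x)\le\zeta,\ \|R(x)\|_2\le\epsilon, $$ where $d(x,\mathcal X)=\inf_{z\in\mathcal X}\|z-x\|_2$. -/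

import Mathlib

open scoped InnerProductSpace

noncomputable section

namespace StructuredConvex

section Polyhedral

variable {V : Type*} [AddCommGroup V] [Module ℝ V]

/-- A polyhedral convex set: the solution set of finitely many affine inequalities. -/
def IsPolyhedral (s : Set V) : Prop :=
  ∃ (n : ℕ) (a : Fin n → V →ₗ[ℝ] ℝ) (b : Fin n → ℝ), s = {x | ∀ i, a i x ≤ b i}

/-- The epigraph of an extended-real-valued function. -/
def epigraph (φ : V → EReal) : Set (V × ℝ) :=
  {p | φ p.1 ≤ (p.2 : EReal)}

/-- Convexity of an extended-real-valued function (convexity of the epigraph). -/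
def IsConvexFun (φ : V → EReal) : Prop :=
  Convex ℝ (epigraph φ)

/-- A polyhedral convex function: one whose epigraph is a polyhedral convex set. -/
def IsPolyhedralFun (φ : V → EReal) : Prop :=
  IsPolyhedral (epigraph φ)

/-- The effective domain. -/
def effDom (φ : V → EReal) : Set V :=
  {x | φ x < ⊤}

end Polyhedral

/-- The set of optimal solutions of `min F`: the minimizers of `F` with `F x < +∞`
(so it is empty when `F` is identically `+∞`). -/
def solutionSet {E : Type*} (F : E → EReal) : Set E :=
  {x | F x < ⊤ ∧ ∀ z, F x ≤ F z}

/-- The optimal value of `min F`. -/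
def optimalValue {E : Type*} (F : E → EReal) : EReal :=
  ⨅ x, F x

section Euclidean

variable {E T : Type*}
  [NormedAddCommGroup E] [InnerProductSpace ℝ E] [FiniteDimensional ℝ E]
  [NormedAddCommGroup T] [InnerProductSpace ℝ T] [FiniteDimensional ℝ T]

/-- The gradient of an extended-real-valued function at a point; it is meant for points in the
interior of the effective domain, near which the function is its real-valued part. -/
def grad (φ : E → EReal) (x : E) : E :=
  gradient (fun u => (φ u).toReal) x

/-- `z` minimizes `(1/2) ‖x - z‖² + P z`. -/
def IsProx (P : E → EReal) (x z : E) : Prop :=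
  ∀ w, (((1 / 2 : ℝ) * ‖x - z‖ ^ 2 : ℝ) : EReal) + P z
    ≤ (((1 / 2 : ℝ) * ‖x - w‖ ^ 2 : ℝ) : EReal) + P w

/-- The proximal map of `P`: `prox P x` is the minimizer over `z` of `(1/2) ‖x - z‖² + P z`
(which exists and is unique when `P` is closed, proper and convex). -/
def prox (P : E → EReal) (x : E) : E :=
  Classical.epsilon (IsProx P x)

/-- The residual map `R x = prox_P (x - ∇f x) - x`. -/
def residual (f P : E → EReal) (x : E) : E :=
  prox P (x - grad f x) - x

/-- The structural assumption on the objective `f + P`. All functions take values in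
`(-∞, +∞]`. -/
structure StructuralAssumption (A : E →ₗ[ℝ] T) (c : E) (h : T → EReal)
    (f P : E → EReal) : Prop where
  /-- `f x = h (A x) + ⟨c, x⟩`. -/
  f_eq : ∀ x, f x = h (A x) + ((⟪c, x⟫_ℝ : ℝ) : EReal)
  h_ne_bot : ∀ y, h y ≠ ⊥
  h_convex : IsConvexFun h
  h_dom_nonempty : (effDom h).Nonempty
  h_dom_open : IsOpen (effDom h)
  h_contDiff : ContDiffOn ℝ 1 (fun y => (h y).toReal) (effDom h)
  h_strong : ∀ V : Set T, IsCompact V → Convex ℝ V → V ⊆ effDom h →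
    ∃ σ : ℝ, 0 < σ ∧ StrongConvexOn V σ (fun y => (h y).toReal)
  h_lipschitz : ∀ V : Set T, IsCompact V → Convex ℝ V → V ⊆ effDom h →
    ∃ L : NNReal, LipschitzOnWith L (grad h) V
  P_ne_bot : ∀ x, P x ≠ ⊥
  P_dom_nonempty : (effDom P).Nonempty
  P_convex : IsConvexFun P
  P_closed : LowerSemicontinuous P

/-- The assumption on the optimal solution set of `min (f + P)`: non-empty and compact. -/
def SolutionSetAssumption (f P : E → EReal) : Prop :=
  (solutionSet (f + P)).Nonempty ∧ IsCompact (solutionSet (f + P))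

/-- The error bound with proximal map-based residual function for `min (f + P)`. -/
def ProxErrorBound (f P : E → EReal) : Prop :=
  ∀ ζ : ℝ, optimalValue (f + P) ≤ (ζ : EReal) →
    ∃ κ : ℝ, 0 < κ ∧ ∃ ε : ℝ, 0 < ε ∧
      ∀ x : E, (f + P) x ≤ (ζ : EReal) → ‖residual f P x‖ ≤ ε →
        Metric.infDist x (solutionSet (f + P)) ≤ κ * ‖residual f P x‖

end Euclidean

theorem isProx_prox {F : Type*} [NormedAddCommGroup F] {P : F → EReal} {x : F}
    (hex : ∃ z, IsProx P x z) : IsProx P x (prox P x) :=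
  Classical.epsilon_spec hex

end StructuredConvex

end

noncomputable section

namespace StructuredConvex

open Filter Topology

/-! Fix a solution `x₀`, put `y₀ = A x₀` and `v₀ = -∇f x₀`. Every `x'` with `A x' = y₀` and `v₀ ∈ ∂P
x'` is a solution, and these points form a polyhedron. So it suffices to bound the distance from `x`
to it. With `r = R x`, optimality of the prox says that `-r - ∇f x` is a subgradient of `P` at `x +
r`. A polyhedral `P` has finitely many subdifferentials, all closed, so once this vector is near
`v₀`, `v₀` itself is a subgradient at `x + r` (`exists_isSubgradient_of_norm_sub_le`). Hoffman's
bound (`exists_hoffman_bound`) then gives `x'` with `‖x + r - x'‖ = O(‖A x - y₀‖ + ‖r‖)`. It remains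
to show `s = ‖A x - y₀‖ = O(‖r‖)`. Monotonicity of `∂P` between `x + r` and `x'`, with strong
convexity and the Lipschitz gradient near `y₀`, gives `s² = O(‖r‖ (s + ‖r‖))`. The local constants
apply only once `s` is small. This follows from the same monotonicity inequality at `x₀`, given
bounds on `x` (`exists_norm_le_of_isBounded_solutions`) and on `∇h (A x)`
(`norm_gradient_le_of_closedBall`). Hence one ball around `y₀` suffices, although `A x` may approach
the boundary of `dom h`. -/

theorem deriv_le_of_sub_le {φ : ℝ → ℝ} {c C K : ℝ} (hφ : HasDerivAt φ c 0)
    (hle : ∀ᶠ t in 𝓝[>] (0 : ℝ), φ t - φ 0 ≤ t * C + t ^ 2 * K) : c ≤ C := by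
  have h1 : Tendsto (slope φ 0) (𝓝[>] 0) (𝓝 c) :=
    hφ.tendsto_slope.mono_left (nhdsWithin_mono _ fun t ht => ne_of_gt ht)
  have h2 : Tendsto (fun t : ℝ => C + t * K) (𝓝[>] 0) (𝓝 C) := by
    have : Tendsto (fun t : ℝ => C + t * K) (𝓝 0) (𝓝 (C + 0 * K)) :=
      (by fun_prop : Continuous fun t : ℝ => C + t * K).tendsto 0
    simpa using this.mono_left nhdsWithin_le_nhds
  refine le_of_tendsto_of_tendsto h1 h2 ?_
  filter_upwards [hle, self_mem_nhdsWithin] with t ht ht0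
  rw [slope_def_field, sub_zero, div_le_iff₀ ht0]
  linarith

theorem coe_toReal_of_mem_effDom {V : Type*} {φ : V → EReal} (hbot : ∀ x, φ x ≠ ⊥) {x : V} (hx : x ∈ effDom φ) :
    (((φ x).toReal : ℝ) : EReal) = φ x :=
  EReal.coe_toReal (ne_of_lt hx) (hbot x)

theorem IsConvexFun.convexOn_toReal {V : Type*} [AddCommGroup V] [Module ℝ V] {φ : V → EReal}
    (hφ : IsConvexFun φ)
    (hbot : ∀ x, φ x ≠ ⊥) : ConvexOn ℝ (effDom φ) fun x => (φ x).toReal := by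
  have key : ∀ x ∈ effDom φ, ∀ y ∈ effDom φ, ∀ a b : ℝ, 0 ≤ a → 0 ≤ b → a + b = 1 →
      φ (a • x + b • y) ≤ ((a * (φ x).toReal + b * (φ y).toReal : ℝ) : EReal) := by
    intro x hx y hy a b ha hb hab
    have hx' : (x, (φ x).toReal) ∈ epigraph φ := (coe_toReal_of_mem_effDom hbot hx).ge
    have hy' : (y, (φ y).toReal) ∈ epigraph φ := (coe_toReal_of_mem_effDom hbot hy).ge
    exact hφ hx' hy' ha hb hab
  refine ⟨fun x hx y hy a b ha hb hab => (key x hx y hy a b ha hb hab).trans_lt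
    (EReal.coe_lt_top _), fun x hx y hy a b ha hb hab => ?_⟩
  have h1 := key x hx y hy a b ha hb hab
  have h2 := coe_toReal_of_mem_effDom hbot (h1.trans_lt (EReal.coe_lt_top _))
  rw [← h2] at h1
  exact EReal.coe_le_coe_iff.1 h1

/-! ### Growth of strongly convex functions above their linearization. -/

section Growth

variable {T : Type*} [NormedAddCommGroup T] [InnerProductSpace ℝ T]

theorem _root_.StrongConvexOn.add_inner_add_le [CompleteSpace T] {V : Set T} {σ : ℝ} {φ : T → ℝ}
    (hφ : StrongConvexOn V σ φ) {y w g : T} (hy : y ∈ V) (hw : w ∈ V) (hg : HasGradientAt φ g y) :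
    φ y + ⟪g, w - y⟫_ℝ + σ / 2 * ‖w - y‖ ^ 2 ≤ φ w := by
  have hd : HasDerivAt (fun t : ℝ => φ (y + t • (w - y))) ⟪g, w - y⟫_ℝ 0 := by
    have h1 : HasDerivAt (fun t : ℝ => y + t • (w - y)) (w - y) 0 := by
      simpa using ((hasDerivAt_id (0 : ℝ)).smul_const (w - y)).const_add y
    have h2 : HasFDerivAt φ (InnerProductSpace.toDual ℝ T g) (y + (0 : ℝ) • (w - y)) := by
      simpa using hg.hasFDerivAt
    have h3 := h2.comp_hasDerivAt (0 : ℝ) h1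
    rw [InnerProductSpace.toDual_apply_apply] at h3
    exact h3
  have := deriv_le_of_sub_le (C := φ w - φ y - σ / 2 * ‖w - y‖ ^ 2)
    (K := σ / 2 * ‖w - y‖ ^ 2) hd ?_
  · linarith
  · filter_upwards [Ioo_mem_nhdsGT (zero_lt_one' ℝ)] with t ⟨ht0, ht1⟩
    have h := hφ.2 hw hy ht0.le (sub_nonneg.2 ht1.le) (by ring)
    have e : t • w + (1 - t) • y = y + t • (w - y) := by module
    rw [e] at h
    simp only [smul_eq_mul, zero_smul, add_zero] at h ⊢
    nlinarith

theorem _root_.ConvexOn.add_inner_le [CompleteSpace T] {V : Set T} {φ : T → ℝ}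
    (hφ : ConvexOn ℝ V φ) {y w g : T} (hy : y ∈ V) (hw : w ∈ V) (hg : HasGradientAt φ g y) :
    φ y + ⟪g, w - y⟫_ℝ ≤ φ w := by
  simpa using (strongConvexOn_zero.2 hφ).add_inner_add_le hy hw hg

/-- A convex function that is strongly convex on a ball grows at least linearly, relative to its
linearization at the center, outside the ball. -/
theorem growth_of_strongConvexOn_closedBall [CompleteSpace T] {U : Set T} {φ : T → ℝ} {σ δ : ℝ}
    {y₀ g : T}
    (hU : ConvexOn ℝ U φ) (hδ : 0 < δ) (hball : Metric.closedBall y₀ δ ⊆ U)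
    (hσ : StrongConvexOn (Metric.closedBall y₀ δ) σ φ) (hg : HasGradientAt φ g y₀)
    {y : T} (hy : y ∈ U) :
    σ / 2 * min δ ‖y - y₀‖ * ‖y - y₀‖ ≤ φ y - φ y₀ - ⟪g, y - y₀⟫_ℝ := by
  have h0 : y₀ ∈ Metric.closedBall y₀ δ := Metric.mem_closedBall_self hδ.le
  rcases le_total ‖y - y₀‖ δ with h | h
  · have := hσ.add_inner_add_le h0 (w := y) (by simpa [dist_eq_norm] using h) hg
    rw [min_eq_right h]
    nlinarith
  · rw [min_eq_left h]
    have hs : 0 < ‖y - y₀‖ := hδ.trans_le h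
    -- Pull `y` back along the segment to the sphere of radius `δ`. Strong convexity gives the gap
    -- `σ / 2 * δ ^ 2` there, and plain convexity carries it out to `y`, scaled by `1 / t`.
    set t := δ / ‖y - y₀‖ with ht
    have ht0 : 0 < t := by positivity
    have ht1 : t ≤ 1 := (div_le_one hs).2 h
    have hts : t * ‖y - y₀‖ = δ := by rw [ht]; field_simp
    have hn : ‖(y₀ + t • (y - y₀)) - y₀‖ = δ := by
      rw [add_sub_cancel_left, norm_smul, Real.norm_of_nonneg ht0.le, hts]
    have h1 := hσ.add_inner_add_le h0 (w := y₀ + t • (y - y₀))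
      (by simp only [Metric.mem_closedBall, dist_eq_norm]; exact hn.le) hg
    rw [hn, add_sub_cancel_left, inner_smul_right] at h1
    have h2 := hU.2 hy (hball h0) ht0.le (sub_nonneg.2 ht1) (by ring)
    have e : t • y + (1 - t) • y₀ = y₀ + t • (y - y₀) := by module
    rw [e] at h2
    simp only [smul_eq_mul] at h2
    have h3 : t * (σ / 2 * δ * ‖y - y₀‖) ≤ t * (φ y - φ y₀ - ⟪g, y - y₀⟫_ℝ) := by
      have : t * (σ / 2 * δ * ‖y - y₀‖) = σ / 2 * δ ^ 2 := by rw [← hts]; ring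
      rw [this]; linarith
    exact le_of_mul_le_mul_left h3 ht0

end Growth

/-! ### Hoffman's error bound. -/

section Hoffman

variable {E T : Type*}
  [NormedAddCommGroup E] [InnerProductSpace ℝ E] [FiniteDimensional ℝ E]
  [NormedAddCommGroup T] [InnerProductSpace ℝ T]

/-- By homogeneity only unit vectors matter, and `‖A u‖` has a positive minimum on the compact set
of unit vectors of `K`. -/
theorem exists_pos_forall_norm_le_of_cone {K : Set E} (hK : IsClosed K)
    (hcone : ∀ u ∈ K, ∀ t : ℝ, 0 < t → t • u ∈ K) (A : E →ₗ[ℝ] T)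
    (hker : ∀ u ∈ K, A u = 0 → u = 0) : ∃ κ : ℝ, 0 < κ ∧ ∀ u ∈ K, ‖u‖ ≤ κ * ‖A u‖ := by
  have hA : Continuous A := A.continuous_of_finiteDimensional
  have hS : IsCompact (Metric.sphere (0 : E) 1 ∩ K) := (isCompact_sphere 0 1).inter_right hK
  have hpos : ∃ κ : ℝ, 0 < κ ∧ ∀ u ∈ Metric.sphere (0 : E) 1 ∩ K, 1 ≤ κ * ‖A u‖ := by
    rcases (Metric.sphere (0 : E) 1 ∩ K).eq_empty_or_nonempty with h | h
    · exact ⟨1, one_pos, by simp [h]⟩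
    · obtain ⟨u₀, hu₀, hmin⟩ := hS.exists_isMinOn h hA.norm.continuousOn
      have h0 : 0 < ‖A u₀‖ := by
        rw [norm_pos_iff]
        intro h
        have := hker u₀ hu₀.2 h
        have h1 := hu₀.1
        simp [this] at h1
      refine ⟨‖A u₀‖⁻¹, by positivity, fun u hu => ?_⟩
      rw [← div_eq_inv_mul, le_div_iff₀ h0, one_mul]
      exact hmin hu
  obtain ⟨κ, hκ, h⟩ := hpos
  refine ⟨κ, hκ, fun u hu => ?_⟩
  rcases eq_or_ne u 0 with rfl | hu0
  · simp
  · have hn : 0 < ‖u‖ := norm_pos_iff.2 hu0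
    have := h (‖u‖⁻¹ • u) ⟨by simp [norm_smul, hn.ne'], hcone u hu _ (by positivity)⟩
    rw [map_smul, norm_smul, norm_inv, norm_norm] at this
    field_simp at this
    linarith

/-- Moving from a point of a polyhedron along a direction that respects the active constraints. -/
theorem exists_pos_forall_le_of_active {V : Type*} [AddCommGroup V] [Module ℝ V] {n : ℕ}
    (a : Fin n → V →ₗ[ℝ] ℝ) (b : Fin n → ℝ) {x d : V} (hx : ∀ i, a i x ≤ b i)
    (hd : ∀ i, a i x = b i → a i d ≤ 0) :
    ∃ t : ℝ, 0 < t ∧ t ≤ 1 ∧ ∀ i, a i (x + t • d) ≤ b i := by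
  have h : ∀ i, ∀ᶠ t : ℝ in 𝓝[>] 0, a i (x + t • d) ≤ b i := by
    intro i
    rcases (hx i).lt_or_eq with hlt | heq
    · have hc : Tendsto (fun t : ℝ => a i x + t * a i d) (𝓝[>] 0) (𝓝 (a i x + 0 * a i d)) :=
        ((by fun_prop : Continuous fun t : ℝ => a i x + t * a i d).tendsto 0).mono_left
          nhdsWithin_le_nhds
      rw [zero_mul, add_zero] at hc
      filter_upwards [hc.eventually_lt_const hlt] with t ht
      simpa using ht.le
    · filter_upwards [self_mem_nhdsWithin] with t ht
      have := mul_nonpos_of_nonneg_of_nonpos (le_of_lt ht) (hd i heq)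
      simp only [map_add, map_smul, smul_eq_mul]
      linarith
  obtain ⟨t, ht, ht'⟩ := ((eventually_all.2 h).and
    (Ioc_mem_nhdsGT (zero_lt_one' ℝ))).exists
  exact ⟨t, ht'.1, ht'.2, ht⟩

/-- Hoffman's error bound for the linear equations `A x = y` over a polyhedron. -/
theorem exists_hoffman_bound {n : ℕ} (a : Fin n → E →ₗ[ℝ] ℝ) (b : Fin n → ℝ) (A : E →ₗ[ℝ] T)
    {x₀ : E} (hx₀ : ∀ i, a i x₀ ≤ b i) :
    ∃ κ : ℝ, 0 < κ ∧ ∀ z, (∀ i, a i z ≤ b i) →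
      ∃ x, (∀ i, a i x ≤ b i) ∧ A x = A x₀ ∧ ‖z - x‖ ≤ κ * ‖A z - A x₀‖ := by
  have ha : ∀ i, Continuous (a i) := fun i => (a i).continuous_of_finiteDimensional
  have hA : Continuous A := A.continuous_of_finiteDimensional
  -- `K I` will contain `z - x`, for `x` the projection of `z` and `I` its active set: the second
  -- condition is the normality of a projection. Testing it with `d = u` shows that `A` has trivial
  -- kernel on `K I`. There are finitely many `I`, so one constant serves all.
  let K : Set (Fin n) → Set E := fun I =>
    {u | (∀ i ∈ I, a i u ≤ 0) ∧ ∀ d, (∀ i ∈ I, a i d ≤ 0) → A d = 0 → ⟪u, d⟫_ℝ ≤ 0}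
  have hK : ∀ I, ∃ κ : ℝ, 0 < κ ∧ ∀ u ∈ K I, ‖u‖ ≤ κ * ‖A u‖ := by
    intro I
    refine exists_pos_forall_norm_le_of_cone ?_ ?_ A ?_
    · have : K I = (⋂ i ∈ I, {u | a i u ≤ 0}) ∩
          ⋂ (d : E) (_ : ∀ i ∈ I, a i d ≤ 0) (_ : A d = 0), {u | ⟪u, d⟫_ℝ ≤ 0} := by
        ext u; simp [K]
      rw [this]
      refine IsClosed.inter (isClosed_biInter fun i _ => isClosed_le (ha i) continuous_const) ?_
      exact isClosed_iInter fun d => isClosed_iInter fun _ => isClosed_iInter fun _ =>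
        isClosed_le (by fun_prop) continuous_const
    · rintro u ⟨h1, h2⟩ t ht
      refine ⟨fun i hi => ?_, fun d hd hAd => ?_⟩
      · rw [map_smul, smul_eq_mul]; exact mul_nonpos_of_nonneg_of_nonpos ht.le (h1 i hi)
      · rw [real_inner_smul_left]; exact mul_nonpos_of_nonneg_of_nonpos ht.le (h2 d hd hAd)
    · rintro u ⟨h1, h2⟩ hu
      have := h2 u h1 hu
      rwa [real_inner_self_nonpos] at this
  choose κ hκ hκK using hK
  obtain ⟨κ₀, hκ₀⟩ := (Set.finite_range κ).bddAbove
  have hle : ∀ I, κ I ≤ κ₀ := fun I => hκ₀ ⟨I, rfl⟩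
  refine ⟨κ₀, (hκ ∅).trans_le (hle ∅), fun z hz => ?_⟩
  let X : Set E := {x | (∀ i, a i x ≤ b i) ∧ A x = A x₀}
  have hXc : IsClosed X := by
    have : X = (⋂ i, {x | a i x ≤ b i}) ∩ {x | A x = A x₀} := by ext; simp [X]
    rw [this]
    exact (isClosed_iInter fun i => isClosed_le (ha i) continuous_const).inter
      (isClosed_eq hA continuous_const)
  have hXne : X.Nonempty := ⟨x₀, hx₀, rfl⟩
  obtain ⟨x, hx, hmin⟩ := hXc.exists_infDist_eq_dist hXne z
  have hXconv : Convex ℝ X := by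
    rintro u ⟨hu, hu'⟩ w ⟨hw, hw'⟩ s t hs ht hst
    refine ⟨fun i => ?_, ?_⟩
    · have h1 := mul_le_mul_of_nonneg_left (hu i) hs
      have h2 := mul_le_mul_of_nonneg_left (hw i) ht
      have h3 : s * b i + t * b i = b i := by rw [← add_mul, hst, one_mul]
      simp only [map_add, map_smul, smul_eq_mul]
      linarith
    · rw [map_add, map_smul, map_smul, hu', hw', ← add_smul, hst, one_smul]
  have hproj : ∀ w ∈ X, ⟪z - x, w - x⟫_ℝ ≤ 0 := by
    refine (norm_eq_iInf_iff_real_inner_le_zero hXconv hx).1 ?_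
    rw [← dist_eq_norm, ← hmin, Metric.infDist_eq_iInf]
    simp only [dist_eq_norm]
  refine ⟨x, hx.1, hx.2, ?_⟩
  have hmem : z - x ∈ K {i | a i x = b i} := by
    refine ⟨fun i hi => ?_, fun d hd hAd => ?_⟩
    · have hi' : a i x = b i := hi
      rw [map_sub, hi']; linarith [hz i]
    · obtain ⟨t, ht, -, htd⟩ := exists_pos_forall_le_of_active a b hx.1 (d := d) fun i hi => hd i hi
      have := hproj (x + t • d) ⟨htd, by simp [hAd, hx.2]⟩
      rw [add_sub_cancel_left, inner_smul_right] at this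
      exact nonpos_of_mul_nonpos_right this ht
  have := hκK _ _ hmem
  rw [map_sub, hx.2] at this
  exact this.trans (mul_le_mul_of_nonneg_right (hle _) (norm_nonneg _))

end Hoffman

/-! ### Subgradients, polyhedral functions and the proximal map. -/

section Subgradient

variable {E : Type*} [NormedAddCommGroup E] [InnerProductSpace ℝ E]

/-- `v` is a subgradient of `P` at the point `z` of its effective domain. -/
def IsSubgradient (P : E → EReal) (z v : E) : Prop :=
  ∃ p : ℝ, P z = p ∧ ∀ w (t : ℝ), P w ≤ t → p + ⟪v, w - z⟫_ℝ ≤ t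

variable {P : E → EReal}

theorem IsSubgradient.inner_sub_nonneg {z z' v v' : E} (h : IsSubgradient P z v)
    (h' : IsSubgradient P z' v') : 0 ≤ ⟪v - v', z - z'⟫_ℝ := by
  obtain ⟨p, hp, h⟩ := h
  obtain ⟨p', hp', h'⟩ := h'
  have h1 := h z' p' hp'.le
  have h2 := h' z p hp.le
  have e1 : ⟪v, z' - z⟫_ℝ = -⟪v, z - z'⟫_ℝ := by rw [← inner_neg_right, neg_sub]
  rw [inner_sub_left]
  linarith

/-- A point where a fixed vector is a subgradient is recognized by one inequality. -/
theorem IsSubgradient.of_le {x z v : E} {p : ℝ} (h : IsSubgradient P x v) (hp : P x = p)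
    (hz : P z ≤ ((p + ⟪v, z - x⟫_ℝ : ℝ) : EReal)) (hbot : P z ≠ ⊥) : IsSubgradient P z v := by
  obtain ⟨p', hp', h⟩ := h
  obtain rfl : p' = p := EReal.coe_injective (hp'.symm.trans hp)
  obtain ⟨q, hq⟩ : ∃ q : ℝ, P z = q :=
    ⟨_, (EReal.coe_toReal (hz.trans_lt (EReal.coe_lt_top _)).ne hbot).symm⟩
  rw [hq, EReal.coe_le_coe_iff] at hz
  refine ⟨q, hq, fun w t hw => ?_⟩
  have h1 := h w t hw
  have : w - x = (w - z) + (z - x) := by abel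
  rw [this, inner_add_right] at h1
  linarith

theorem IsSubgradient.le {x z v : E} {p : ℝ} (hp : P x = p)
    (h' : IsSubgradient P z v) : P z ≤ ((p + ⟪v, z - x⟫_ℝ : ℝ) : EReal) := by
  obtain ⟨q, hq, h'⟩ := h'
  have := h' x p hp.le
  have e : ⟪v, x - z⟫_ℝ = -⟪v, z - x⟫_ℝ := by rw [← inner_neg_right, neg_sub]
  rw [hq, EReal.coe_le_coe_iff]
  linarith

/-- Subgradients of a polyhedral function that are close enough to a given vector `v₀` can be
replaced by `v₀`: the subdifferential takes finitely many values, and these are closed. -/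
theorem IsPolyhedralFun.exists_isSubgradient_of_norm_sub_le (hP : IsPolyhedralFun P) (v₀ : E) :
    ∃ ε : ℝ, 0 < ε ∧ ∀ z v, IsSubgradient P z v → ‖v - v₀‖ ≤ ε → IsSubgradient P z v₀ := by
  obtain ⟨n, a, b, hab⟩ := hP
  have hepi : ∀ w (t : ℝ), P w ≤ t ↔ ∀ i, a i (w, t) ≤ b i := fun w t => by
    have : (w, t) ∈ epigraph P ↔ (w, t) ∈ {x | ∀ i, a i x ≤ b i} := by rw [hab]
    exact this
  -- The subdifferential at `z` depends only on the constraints active at `(z, P z)`: being a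
  -- subgradient means that `(v, -1)` is nonpositive on the cone they cut out.
  let S : Set (Fin n) → Set E := fun I =>
    {v | ∀ d : E × ℝ, (∀ i ∈ I, a i d ≤ 0) → ⟪v, d.1⟫_ℝ ≤ d.2}
  have hS : ∀ I, IsClosed (S I) := fun I => by
    have : S I = ⋂ (d : E × ℝ) (_ : ∀ i ∈ I, a i d ≤ 0), {v | ⟪v, d.1⟫_ℝ ≤ d.2} := by
      ext; simp [S]
    rw [this]
    exact isClosed_iInter fun d => isClosed_iInter fun _ =>
      isClosed_le (by fun_prop) continuous_const
  have hiff : ∀ z v (p : ℝ), P z = p →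
      (IsSubgradient P z v ↔ v ∈ S {i | a i (z, p) = b i}) := by
    intro z v p hp
    constructor
    · rintro ⟨p', hp', h⟩ d hd
      obtain rfl : p' = p := EReal.coe_injective (hp'.symm.trans hp)
      obtain ⟨t, ht, -, htd⟩ := exists_pos_forall_le_of_active a b (x := (z, p')) (d := d)
        ((hepi z p').1 hp.le) fun i hi => hd i hi
      have := h (z + t • d.1) (p' + t * d.2) ((hepi _ _).2 htd)
      rw [add_sub_cancel_left, inner_smul_right] at this
      exact le_of_mul_le_mul_left (by linarith) ht
    · intro hv
      refine ⟨p, hp, fun w t hw => ?_⟩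
      have := hv ((w, t) - (z, p)) fun i hi => by
        have hi' : a i (z, p) = b i := hi
        rw [map_sub, hi', sub_nonpos]
        exact (hepi w t).1 hw i
      simp only [Prod.fst_sub, Prod.snd_sub] at this
      linarith
  have hev : ∀ᶠ v in 𝓝 v₀, ∀ I : Set (Fin n), v ∈ S I → v₀ ∈ S I := by
    rw [eventually_all]
    intro I
    by_cases h : v₀ ∈ S I
    · exact Eventually.of_forall fun _ _ => h
    · filter_upwards [(hS I).isOpen_compl.mem_nhds h] with v hv hv'
      exact absurd hv' hv
  obtain ⟨ε, hε, hball⟩ := Metric.nhds_basis_closedBall.eventually_iff.1 hev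
  refine ⟨ε, hε, fun z v hv hle => ?_⟩
  obtain ⟨p, hp, -⟩ := id hv
  exact (hiff z v₀ p hp).2 (hball (by simpa [dist_eq_norm] using hle) _ ((hiff z v p hp).1 hv))

/-- Compare `z` with `z + s • (w - z)`: the quadratic term contributes only order `s ^ 2` beyond its
linear part, which vanishes in the limit of slopes. -/
theorem IsProx.isSubgradient (hconv : IsConvexFun P) {x z : E} (hz : IsProx P x z)
    {p : ℝ} (hp : P z = p) : IsSubgradient P z (x - z) := by
  refine ⟨p, hp, fun w t hw => ?_⟩
  have hφ : HasDerivAt (fun s : ℝ => s * ⟪x - z, w - z⟫_ℝ) ⟪x - z, w - z⟫_ℝ 0 := by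
    simpa using (hasDerivAt_id (0 : ℝ)).mul_const ⟪x - z, w - z⟫_ℝ
  have := deriv_le_of_sub_le (C := t - p) (K := 1 / 2 * ‖w - z‖ ^ 2) hφ ?_
  · linarith
  · filter_upwards [Ioo_mem_nhdsGT (zero_lt_one' ℝ)] with s ⟨hs0, hs1⟩
    have h1 : (s • (w, t) + (1 - s) • (z, p) : E × ℝ) ∈ epigraph P :=
      hconv (show (w, t) ∈ epigraph P from hw) (show (z, p) ∈ epigraph P from hp.le) hs0.le
        (sub_nonneg.2 hs1.le) (by ring)
    have e : s • w + (1 - s) • z = z + s • (w - z) := by module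
    have h2 : P (z + s • (w - z)) ≤ ((s * t + (1 - s) * p : ℝ) : EReal) := by
      rw [← e]; exact h1
    have h3 := (hz (z + s • (w - z))).trans (add_le_add_right h2 _)
    rw [hp, ← EReal.coe_add, ← EReal.coe_add, EReal.coe_le_coe_iff] at h3
    have h4 : ‖x - (z + s • (w - z))‖ ^ 2
        = ‖x - z‖ ^ 2 - 2 * (s * ⟪x - z, w - z⟫_ℝ) + s ^ 2 * ‖w - z‖ ^ 2 := by
      rw [← sub_sub, norm_sub_sq_real, inner_smul_right, norm_smul, mul_pow, Real.norm_eq_abs,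
        sq_abs]
    rw [h4] at h3
    simp only [zero_mul, sub_zero]
    nlinarith

/-- The subgradient supplies an affine minorant of `P`, which makes the prox objective coercive.
Minimizing over pairs in the closed epigraph keeps the objective continuous and real-valued. -/
theorem exists_isProx [FiniteDimensional ℝ E] (hclosed : IsClosed (epigraph P))
    (hbot : ∀ x, P x ≠ ⊥) {x₀ v : E}
    (hsub : IsSubgradient P x₀ v) (x : E) : ∃ z, ∃ p : ℝ, P z = p ∧ IsProx P x z := by
  obtain ⟨p₀, hp₀, hsub⟩ := hsub
  let φ : E × ℝ → ℝ := fun q => 1 / 2 * ‖x - q.1‖ ^ 2 + q.2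
  have hφ : Continuous φ := by fun_prop
  let K : Set (E × ℝ) := epigraph P ∩ {q | φ q ≤ φ (x₀, p₀)}
  have hKc : IsClosed K := hclosed.inter (isClosed_le hφ continuous_const)
  have hKne : (x₀, p₀) ∈ K := ⟨hp₀.le, le_refl (φ (x₀, p₀))⟩
  have hKb : Bornology.IsBounded K := by
    set c₀ : ℝ := φ (x₀, p₀) - p₀ + ‖v‖ * ‖x - x₀‖ with hc₀
    have hd : ∀ q ∈ K, ‖x - q.1‖ ≤ 2 * ‖v‖ + 2 * |c₀| + 1 ∧
        p₀ - ‖v‖ * (‖x - q.1‖ + ‖x - x₀‖) ≤ q.2 ∧ q.2 ≤ φ (x₀, p₀) := by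
      rintro q ⟨hq1, hq2⟩
      have h1 := hsub q.1 q.2 hq1
      have h2 : 1 / 2 * ‖x - q.1‖ ^ 2 + q.2 ≤ φ (x₀, p₀) := hq2
      have h3 : -(‖v‖ * ‖q.1 - x₀‖) ≤ ⟪v, q.1 - x₀⟫_ℝ :=
        neg_le_of_abs_le (abs_real_inner_le_norm _ _)
      have h4 : ‖q.1 - x₀‖ ≤ ‖x - q.1‖ + ‖x - x₀‖ := by
        have : q.1 - x₀ = (x - x₀) - (x - q.1) := by abel
        rw [this]; exact (norm_sub_le _ _).trans (add_comm _ _).le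
      have h5 := mul_le_mul_of_nonneg_left h4 (norm_nonneg v)
      have h6 : 1 / 2 * ‖x - q.1‖ ^ 2 ≤ c₀ + ‖v‖ * ‖x - q.1‖ := by rw [hc₀]; linarith
      refine ⟨?_, by linarith, by nlinarith [sq_nonneg ‖x - q.1‖]⟩
      by_contra! hcon
      have h7 := le_abs_self c₀
      have h8 := abs_nonneg c₀
      have h9 := norm_nonneg v
      nlinarith
    set B : ℝ := 2 * ‖v‖ + 2 * |c₀| + 1
    refine ((Metric.isBounded_closedBall (x := x) (r := B)).prod (Metric.isBounded_Icc
      (p₀ - ‖v‖ * (B + ‖x - x₀‖)) (φ (x₀, p₀)))).subset fun q hq => ?_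
    obtain ⟨h1, h2, h3⟩ := hd q hq
    refine ⟨by rw [Metric.mem_closedBall, dist_eq_norm, norm_sub_rev]; exact h1, ?_, h3⟩
    have := mul_le_mul_of_nonneg_left (add_le_add_left h1 ‖x - x₀‖) (norm_nonneg v)
    linarith
  obtain ⟨q, hq, hmin⟩ :=
    (Metric.isCompact_of_isClosed_isBounded hKc hKb).exists_isMinOn ⟨_, hKne⟩ hφ.continuousOn
  have hall : ∀ w (t : ℝ), P w ≤ t → φ q ≤ φ (w, t) := fun w t hw => by
    by_cases h : φ (w, t) ≤ φ (x₀, p₀)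
    · exact hmin (show (w, t) ∈ K from ⟨hw, h⟩)
    · exact (hmin hKne).trans (le_of_not_ge h)
  have hqP : P q.1 ≤ (q.2 : EReal) := hq.1
  have hr := EReal.coe_toReal (hqP.trans_lt (EReal.coe_lt_top _)).ne (hbot q.1)
  refine ⟨q.1, (P q.1).toReal, hr.symm, fun w => ?_⟩
  by_cases hw : P w = ⊤
  · rw [hw, EReal.coe_add_top]; exact le_top
  · have hr' := EReal.coe_toReal hw (hbot w)
    have h1 := hall w _ hr'.ge
    refine (add_le_add_right hqP _).trans ?_
    rw [← hr', ← EReal.coe_add, ← EReal.coe_add, EReal.coe_le_coe_iff]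
    exact h1

theorem isSubgradient_prox [FiniteDimensional ℝ E] (hclosed : IsClosed (epigraph P))
    (hbot : ∀ x, P x ≠ ⊥) (hconv : IsConvexFun P) {x₀ v : E} (hsub : IsSubgradient P x₀ v)
    (x : E) : IsSubgradient P (prox P x) (x - prox P x) := by
  obtain ⟨z, p, hp, hz⟩ := exists_isProx hclosed hbot hsub x
  have h := isProx_prox ⟨z, hz⟩
  have hle := h z
  rw [hp, ← EReal.coe_add] at hle
  have hne : P (prox P x) ≠ ⊤ := by
    intro htop
    rw [htop, EReal.coe_add_top] at hle
    exact absurd (hle.trans_lt (EReal.coe_lt_top _)) (lt_irrefl _)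
  exact h.isSubgradient hconv (EReal.coe_toReal hne (hbot _)).symm

theorem IsPolyhedral.isClosed {V : Type*} [NormedAddCommGroup V] [NormedSpace ℝ V]
    [FiniteDimensional ℝ V] {s : Set V} (hs : IsPolyhedral s) : IsClosed s := by
  obtain ⟨n, a, b, rfl⟩ := hs
  rw [Set.ofPred_forall]
  exact isClosed_iInter fun i =>
    isClosed_le (a i).continuous_of_finiteDimensional continuous_const

/-- The points where a fixed vector is a subgradient of a polyhedral function form a polyhedron. -/
theorem IsPolyhedralFun.isPolyhedral_setOf_isSubgradient (hP : IsPolyhedralFun P)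
    (hbot : ∀ x, P x ≠ ⊥) {x v : E} (h : IsSubgradient P x v) :
    IsPolyhedral {z | IsSubgradient P z v} := by
  obtain ⟨p, hp, -⟩ := id h
  obtain ⟨n, a, b, hab⟩ := hP
  -- The supporting affine function at `x` with slope `v` touches `P` exactly where its graph lies
  -- in the epigraph, so the inequalities of the epigraph are pulled back along that graph.
  refine ⟨n, fun i => a i ∘ₗ LinearMap.prod LinearMap.id (innerₛₗ ℝ v),
    fun i => b i - a i (0, p - ⟪v, x⟫_ℝ), ?_⟩
  ext z
  have h1 : IsSubgradient P z v ↔ P z ≤ ((p + ⟪v, z - x⟫_ℝ : ℝ) : EReal) :=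
    ⟨IsSubgradient.le hp, fun h' => h.of_le hp h' (hbot z)⟩
  have h2 : (z, p + ⟪v, z - x⟫_ℝ) ∈ epigraph P ↔
    (z, p + ⟪v, z - x⟫_ℝ) ∈ {x | ∀ i, a i x ≤ b i} := by rw [hab]
  have h3 : ((z, p + ⟪v, z - x⟫_ℝ) : E × ℝ) = (z, ⟪v, z⟫_ℝ) + (0, p - ⟪v, x⟫_ℝ) := by
    rw [inner_sub_right]
    ext <;> simp
    ring
  rw [Set.mem_ofPred_eq, h1]
  refine h2.trans ?_
  rw [h3]
  exact forall_congr' fun i => by rw [map_add]; exact le_sub_iff_add_le.symm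

end Subgradient

/-! ### Boundedness of sublevel sets. -/

theorem exists_norm_le_of_isBounded_solutions {E T : Type*}
    [NormedAddCommGroup E] [InnerProductSpace ℝ E] [FiniteDimensional ℝ E]
    [NormedAddCommGroup T] [InnerProductSpace ℝ T] {P : E → EReal}
    (hclosed : IsClosed (epigraph P)) (hconv : IsConvexFun P) (hbot : ∀ x, P x ≠ ⊥) {A : E →ₗ[ℝ] T} {x₀ v : E} {p₀ : ℝ}
    (hp₀ : P x₀ = p₀) (hsub : IsSubgradient P x₀ v)
    (hbdd : Bornology.IsBounded {x | IsSubgradient P x v ∧ A x = A x₀})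
    {k δ : ℝ} (hk : 0 < k) (hδ : 0 < δ) (ν : ℝ) :
    ∃ B : ℝ, ∀ x (p : ℝ), P x ≤ p →
      p - p₀ - ⟪v, x - x₀⟫_ℝ + k * min δ ‖A x - A x₀‖ * ‖A x - A x₀‖ ≤ ν → ‖x - x₀‖ ≤ B := by
  have hA : Continuous A := A.continuous_of_finiteDimensional
  have hsub' : ∀ w (t : ℝ), P w ≤ t → p₀ + ⟪v, w - x₀⟫_ℝ ≤ t := by
    obtain ⟨p, hp, h⟩ := id hsub
    obtain rfl : p = p₀ := EReal.coe_injective (hp.symm.trans hp₀)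
    exact h
  let ψ : E × ℝ → ℝ := fun q =>
    q.2 - p₀ - ⟪v, q.1 - x₀⟫_ℝ + k * min δ ‖A q.1 - A x₀‖ * ‖A q.1 - A x₀‖
  have hψ : Continuous ψ := by fun_prop
  have hquad : ∀ w, 0 ≤ k * min δ ‖A w - A x₀‖ * ‖A w - A x₀‖ := fun w => by positivity
  obtain ⟨ρ, hρ, hX⟩ := hbdd.subset_ball_lt 0 x₀
  -- On the epigraph `ψ` is nonnegative, and a zero of it lies over a point of the bounded set,
  -- hence inside the ball of radius `ρ`. Truncating at `ψ ≤ 1` gives a compact set on which to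
  -- minimize.
  obtain ⟨μ, hμ, hμψ⟩ : ∃ μ : ℝ, 0 < μ ∧ ∀ q ∈ epigraph P, ‖q.1 - x₀‖ = ρ → μ ≤ ψ q := by
    let K : Set (E × ℝ) := epigraph P ∩ {q | ‖q.1 - x₀‖ = ρ} ∩ {q | ψ q ≤ 1}
    have hKc : IsClosed K := (hclosed.inter (isClosed_eq (by fun_prop) continuous_const)).inter
      (isClosed_le hψ continuous_const)
    have hKb : Bornology.IsBounded K := by
      refine ((Metric.isBounded_closedBall (x := x₀) (r := ρ)).prod (Metric.isBounded_Icc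
        (p₀ - ‖v‖ * ρ) (1 + p₀ + ‖v‖ * ρ))).subset ?_
      rintro q ⟨⟨h1, h2⟩, h3⟩
      have h2' : ‖q.1 - x₀‖ = ρ := h2
      have h3' : q.2 - p₀ - ⟪v, q.1 - x₀⟫_ℝ + k * min δ ‖A q.1 - A x₀‖ * ‖A q.1 - A x₀‖ ≤ 1 := h3
      have h4 := hsub' q.1 q.2 h1
      have h5 := abs_le.1 (abs_real_inner_le_norm v (q.1 - x₀))
      rw [h2'] at h5
      exact ⟨by rw [Metric.mem_closedBall, dist_eq_norm]; exact h2.le, by linarith [h5.1],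
        by linarith [h5.2, hquad q.1]⟩
    have hpos : ∀ q ∈ K, 0 < ψ q := by
      rintro q ⟨⟨h1, h2⟩, -⟩
      have h4 := hsub' q.1 q.2 h1
      have h5 := hquad q.1
      refine lt_of_le_of_ne (by simp only [ψ]; linarith) fun h0 => ?_
      have h0' : 0 = q.2 - p₀ - ⟪v, q.1 - x₀⟫_ℝ +
        k * min δ ‖A q.1 - A x₀‖ * ‖A q.1 - A x₀‖ := h0
      have h6 : k * min δ ‖A q.1 - A x₀‖ * ‖A q.1 - A x₀‖ = 0 := by linarith
      have h7 : A q.1 = A x₀ := by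
        by_contra hne
        have : 0 < ‖A q.1 - A x₀‖ := norm_pos_iff.2 (sub_ne_zero.2 hne)
        have : 0 < k * min δ ‖A q.1 - A x₀‖ * ‖A q.1 - A x₀‖ := by positivity
        linarith
      have h8 : P q.1 ≤ ((p₀ + ⟪v, q.1 - x₀⟫_ℝ : ℝ) : EReal) := by
        have : q.2 = p₀ + ⟪v, q.1 - x₀⟫_ℝ := by linarith
        rw [← this]; exact h1
      have h9 := hX ⟨hsub.of_le hp₀ h8 (hbot _), h7⟩
      rw [Metric.mem_ball, dist_eq_norm] at h9
      exact h9.ne h2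
    rcases K.eq_empty_or_nonempty with hKe | hKne
    · refine ⟨1, one_pos, fun q h1 h2 => ?_⟩
      by_contra! h3
      exact (Set.eq_empty_iff_forall_notMem.1 hKe) q ⟨⟨h1, h2⟩, h3.le⟩
    · obtain ⟨q₀, hq₀, hmin⟩ :=
        (Metric.isCompact_of_isClosed_isBounded hKc hKb).exists_isMinOn hKne hψ.continuousOn
      refine ⟨ψ q₀, hpos q₀ hq₀, fun q h1 h2 => ?_⟩
      rcases le_total (ψ q) 1 with h | h
      · exact hmin (show q ∈ K from ⟨⟨h1, h2⟩, h⟩)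
      · exact (show ψ q₀ ≤ 1 from hq₀.2).trans h
  -- Shrinking towards `(x₀, p₀)` by the factor `t` multiplies `ψ` by at most `t`. Hence `μ ≤ t * ν`
  -- with `t = ρ / ‖x - x₀‖`.
  refine ⟨max ρ (ρ * ν / μ), fun x p hx hν => ?_⟩
  rcases le_total ‖x - x₀‖ ρ with hle | hge
  · exact hle.trans (le_max_left _ _)
  refine le_trans ?_ (le_max_right _ _)
  have hs : 0 < ‖x - x₀‖ := hρ.trans_le hge
  set t := ρ / ‖x - x₀‖ with ht
  have ht0 : 0 < t := by positivity
  have ht1 : t ≤ 1 := (div_le_one hs).2 hge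
  have hts : t * ‖x - x₀‖ = ρ := by rw [ht]; field_simp
  have hmem : (x₀ + t • (x - x₀), p₀ + t * (p - p₀)) ∈ epigraph P := by
    have h1 := hconv (show (x, p) ∈ epigraph P from hx) (show (x₀, p₀) ∈ epigraph P from hp₀.le)
      ht0.le (sub_nonneg.2 ht1) (by ring)
    convert h1 using 1
    ext
    · simp only [Prod.smul_mk, Prod.mk_add_mk]; module
    · simp only [Prod.smul_mk, Prod.mk_add_mk, smul_eq_mul]; ring
  have h1 := hμψ _ hmem (by simp only [add_sub_cancel_left, norm_smul,
    Real.norm_of_nonneg ht0.le, hts])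
  simp only [ψ, add_sub_cancel_left, map_add, map_smul, norm_smul, Real.norm_of_nonneg ht0.le,
    inner_smul_right] at h1
  rw [map_sub] at h1
  set s := ‖A x - A x₀‖
  have hs0 : 0 ≤ s := norm_nonneg _
  have h2 : min δ (t * s) ≤ min δ s :=
    min_le_min_left _ (mul_le_of_le_one_left hs0 ht1)
  have h3 : k * min δ (t * s) * (t * s) ≤ k * min δ s * (t * s) := by gcongr
  have h4 : μ ≤ t * ν := by nlinarith
  rw [le_div_iff₀ hμ, ← hts]
  nlinarith

/-! ### The error bound in terms of subgradients. -/

section ErrorBound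

variable {E T : Type*}
  [NormedAddCommGroup E] [InnerProductSpace ℝ E] [FiniteDimensional ℝ E]
  [NormedAddCommGroup T] [InnerProductSpace ℝ T] [FiniteDimensional ℝ T]

/-- Add the gradient inequalities between `y` and the point of the ball reached from `y₀` in the
direction of `G y`. This controls gradients at points `y` that may be near the boundary of `U`. -/
theorem norm_gradient_le_of_closedBall {U : Set T} {φ : T → ℝ} {G : T → T}
    (hφ : ConvexOn ℝ U φ) (hG : ∀ y ∈ U, HasGradientAt φ (G y) y) {y₀ : T} {δ M : ℝ} (hδ : 0 < δ)
    (hball : Metric.closedBall y₀ δ ⊆ U) (hM : ∀ y ∈ Metric.closedBall y₀ δ, ‖G y‖ ≤ M) {y : T}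
    (hy : y ∈ U) : δ * ‖G y‖ ≤ ⟪G y - G y₀, y - y₀⟫_ℝ + 2 * M * (‖y - y₀‖ + δ) := by
  have hM0 : 0 ≤ M := (norm_nonneg _).trans (hM y₀ (Metric.mem_closedBall_self hδ.le))
  obtain ⟨u, hu, hGu⟩ : ∃ u : T, ‖u‖ ≤ δ ∧ ⟪G y, u⟫_ℝ = δ * ‖G y‖ := by
    rcases eq_or_ne (G y) 0 with h | h
    · exact ⟨0, by simpa using hδ.le, by simp [h]⟩
    · have h' : ‖G y‖ ≠ 0 := norm_ne_zero_iff.2 h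
      refine ⟨(δ / ‖G y‖) • G y, ?_, ?_⟩
      · rw [norm_smul, Real.norm_of_nonneg (by positivity)]
        field_simp; rfl
      · rw [inner_smul_right, real_inner_self_eq_norm_sq]
        field_simp
  have hmem : y₀ + u ∈ Metric.closedBall y₀ δ := by simpa [dist_eq_norm] using hu
  have h1 := hφ.add_inner_le hy (hball hmem) (hG y hy)
  have h2 := hφ.add_inner_le (hball hmem) hy (hG _ (hball hmem))
  have h3 : ⟪G y, y₀ + u - y⟫_ℝ = δ * ‖G y‖ - ⟪G y, y - y₀⟫_ℝ := by
    rw [← hGu, ← inner_sub_right]; congr 1; abel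
  have h4 : ‖y - (y₀ + u)‖ ≤ ‖y - y₀‖ + δ := by
    rw [← sub_sub]; exact (norm_sub_le _ _).trans (by linarith)
  have h5 : -(M * (‖y - y₀‖ + δ)) ≤ ⟪G (y₀ + u), y - (y₀ + u)⟫_ℝ := by
    refine neg_le_of_abs_le ((abs_real_inner_le_norm _ _).trans ?_)
    exact mul_le_mul (hM _ hmem) h4 (norm_nonneg _) hM0
  have h6 : ⟪G y₀, y - y₀⟫_ℝ ≤ M * ‖y - y₀‖ := (real_inner_le_norm _ _).trans
    (mul_le_mul_of_nonneg_right (hM y₀ (Metric.mem_closedBall_self hδ.le)) (norm_nonneg _))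
  rw [inner_sub_left]
  have : 0 ≤ M * δ := by positivity
  linarith

/-- The monotonicity of the subdifferential at a prox-gradient step. -/
theorem inner_le_of_isSubgradient {P : E → EReal} {A : E →ₗ[ℝ] T} {c x r x' : E} {y y' : T}
    (h : IsSubgradient P (x + r) (-r - (LinearMap.adjoint A y + c)))
    (h' : IsSubgradient P x' (-(LinearMap.adjoint A y' + c))) :
    ⟪y - y', A x - A x'⟫_ℝ ≤ -⟪r, x + r - x'⟫_ℝ - ⟪y - y', A r⟫_ℝ := by
  have h1 := h.inner_sub_nonneg h'
  have e : -r - (LinearMap.adjoint A y + c) - -(LinearMap.adjoint A y' + c)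
      = -r - LinearMap.adjoint A (y - y') := by rw [map_sub]; abel
  rw [e, inner_sub_left, inner_neg_left, LinearMap.adjoint_inner_left, map_sub, map_add] at h1
  have e2 : A x + A r - A x' = (A x - A x') + A r := by abel
  rw [e2, inner_add_right] at h1
  linarith

set_option maxHeartbeats 1000000 in
theorem exists_error_bound_of_isSubgradient {U : Set T} {φ : T → ℝ} {G : T → T}
    (hφ : ConvexOn ℝ U φ) (hG : ∀ y ∈ U, HasGradientAt φ (G y) y) {P : E → EReal}
    (hP : IsPolyhedralFun P) (hbot : ∀ x, P x ≠ ⊥) {A : E →ₗ[ℝ] T} {x₀ c : E} {δ σ L : ℝ}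
    (hδ : 0 < δ) (hσ : 0 < σ) (hL : 0 ≤ L) (hball : Metric.closedBall (A x₀) δ ⊆ U)
    (hstrong : StrongConvexOn (Metric.closedBall (A x₀) δ) σ φ)
    (hlip : ∀ y ∈ Metric.closedBall (A x₀) δ, ‖G y - G (A x₀)‖ ≤ L * ‖y - A x₀‖)
    (hsub : IsSubgradient P x₀ (-(LinearMap.adjoint A (G (A x₀)) + c))) {B : ℝ} (hB : 0 ≤ B) :
    ∃ κ : ℝ, 0 < κ ∧ ∃ ε : ℝ, 0 < ε ∧ ∀ x r, A x ∈ U → ‖x - x₀‖ ≤ B → ‖r‖ ≤ ε →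
      IsSubgradient P (x + r) (-r - (LinearMap.adjoint A (G (A x)) + c)) →
      ∃ x', IsSubgradient P x' (-(LinearMap.adjoint A (G (A x₀)) + c)) ∧ A x' = A x₀ ∧
        ‖x - x'‖ ≤ κ * ‖r‖ := by
  set y₀ := A x₀ with hy₀
  have hy₀U : y₀ ∈ U := hball (Metric.mem_closedBall_self hδ.le)
  obtain ⟨a, ha, hA, hA'⟩ : ∃ a : ℝ, 0 < a ∧ (∀ u, ‖A u‖ ≤ a * ‖u‖) ∧
      ∀ y, ‖LinearMap.adjoint A y‖ ≤ a * ‖y‖ := by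
    refine ⟨‖LinearMap.toContinuousLinearMap A‖ +
      ‖LinearMap.toContinuousLinearMap (LinearMap.adjoint A)‖ + 1, by positivity, fun u => ?_,
      fun y => ?_⟩
    · refine ((LinearMap.toContinuousLinearMap A).le_opNorm u).trans ?_
      gcongr
      linarith [norm_nonneg (LinearMap.toContinuousLinearMap (LinearMap.adjoint A))]
    · refine ((LinearMap.toContinuousLinearMap (LinearMap.adjoint A)).le_opNorm y).trans ?_
      gcongr
      linarith [norm_nonneg (LinearMap.toContinuousLinearMap A)]
  obtain ⟨ε₀, hε₀, hstable⟩ :=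
    hP.exists_isSubgradient_of_norm_sub_le (-(LinearMap.adjoint A (G y₀) + c))
  obtain ⟨n, α, β, hαβ⟩ := hP.isPolyhedral_setOf_isSubgradient hbot hsub
  have hmem : ∀ z, IsSubgradient P z (-(LinearMap.adjoint A (G y₀) + c)) ↔ ∀ i, α i z ≤ β i :=
    fun z => Set.ext_iff.1 hαβ z
  obtain ⟨κ₀, hκ₀, hhoff⟩ := exists_hoffman_bound α β A ((hmem x₀).1 hsub)
  set M := ‖G y₀‖ + L * δ with hM
  have hM0 : 0 ≤ M := by positivity
  have hGM : ∀ y ∈ Metric.closedBall y₀ δ, ‖G y‖ ≤ M := fun y hy => by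
    have h1 := hlip y hy
    have h2 : ‖G y‖ ≤ ‖G y - G y₀‖ + ‖G y₀‖ := by simpa using norm_add_le (G y - G y₀) (G y₀)
    have h3 : L * ‖y - y₀‖ ≤ L * δ := by
      rw [Metric.mem_closedBall, dist_eq_norm] at hy; gcongr
    linarith
  -- For `s ≤ δ'` the Lipschitz bound applies and `a * L * s ≤ ε₀ / 2`; the other half of `ε₀` is
  -- left for `r`.
  set δ' := min δ (ε₀ / (2 * a * (L + 1))) with hδ'
  have hδ'0 : 0 < δ' := by positivity
  set N := 2 / δ * (B + δ * M + 2 * M * (a * B + δ)) + M with hN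
  have hN0 : 0 ≤ N := by positivity
  -- The bound `δ / (2 * a)` lets `a * ‖r‖ * D` be absorbed in the gradient estimate `D ≤ N`; the
  -- last bound makes `s > δ'` contradict the growth inequality.
  set ε := min (min 1 (δ / (2 * a))) (min (ε₀ / 2) (σ / 4 * δ' ^ 2 / (B + a * N + 1))) with hε
  set C := (2 / σ) * (κ₀ + κ₀ * a + a * L) with hC
  have hC0 : 0 ≤ C := by positivity
  refine ⟨1 + κ₀ * (2 * C + 1 + a), by positivity, ε, by positivity,
    fun x r hx hxB hr hxr => ?_⟩
  have hr1 : ‖r‖ ≤ 1 := hr.trans ((min_le_left _ _).trans (min_le_left _ _))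
  have hr2 : a * ‖r‖ ≤ δ / 2 := by
    have : ‖r‖ ≤ δ / (2 * a) := hr.trans ((min_le_left _ _).trans (min_le_right _ _))
    rw [le_div_iff₀ (by positivity)] at this
    linarith
  have hr3 : ‖r‖ ≤ ε₀ / 2 := hr.trans ((min_le_right _ _).trans (min_le_left _ _))
  have hr4 : ‖r‖ * (B + a * N + 1) ≤ σ / 4 * δ' ^ 2 := by
    rw [← le_div_iff₀ (by positivity)]
    exact hr.trans ((min_le_right _ _).trans (min_le_right _ _))
  have hr0 := norm_nonneg r
  have hAr := hA r
  set s := ‖A x - y₀‖ with hs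
  have hs0 : 0 ≤ s := norm_nonneg _
  have hsB : s ≤ a * B := by
    rw [hs, hy₀, ← map_sub]
    exact (hA _).trans (by gcongr)
  set D := ‖G (A x) - G y₀‖ with hD
  have hD0 : 0 ≤ D := norm_nonneg _
  have hArD : -⟪G (A x) - G y₀, A r⟫_ℝ ≤ a * ‖r‖ * D := by
    have := neg_le_of_abs_le (abs_real_inner_le_norm (G (A x) - G y₀) (A r))
    have h2 : D * ‖A r‖ ≤ D * (a * ‖r‖) := by gcongr
    linarith
  have hgrowth : ∀ x', A x' = y₀ → IsSubgradient P x' (-(LinearMap.adjoint A (G y₀) + c)) →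
      ⟪G (A x) - G y₀, A x - y₀⟫_ℝ ≤ -⟪r, x + r - x'⟫_ℝ + a * ‖r‖ * D := by
    intro x' hx' hsub'
    have := inner_le_of_isSubgradient hxr hsub'
    rw [hx'] at this
    linarith
  have h1 : ⟪G (A x) - G y₀, A x - y₀⟫_ℝ ≤ ‖r‖ * B + a * ‖r‖ * D := by
    have h := hgrowth x₀ rfl hsub
    have e : x + r - x₀ = (x - x₀) + r := by abel
    rw [e, inner_add_right, real_inner_self_eq_norm_sq] at h
    have h2 := neg_le_of_abs_le (abs_real_inner_le_norm r (x - x₀))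
    have h3 : ‖r‖ * ‖x - x₀‖ ≤ ‖r‖ * B := by gcongr
    linarith [sq_nonneg ‖r‖]
  have hGy₀ : ‖G y₀‖ ≤ M := hGM _ (Metric.mem_closedBall_self hδ.le)
  have hDN : D ≤ N := by
    have h2 := norm_gradient_le_of_closedBall hφ hG hδ hball hGM hx
    have h3 : D ≤ ‖G (A x)‖ + M := (norm_sub_le _ _).trans (by linarith)
    have h4 : a * ‖r‖ * D ≤ δ / 2 * D := by gcongr
    have h5 : 2 * M * (‖A x - y₀‖ + δ) ≤ 2 * M * (a * B + δ) := by gcongr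
    have h6 : ‖r‖ * B ≤ B := mul_le_of_le_one_left hB hr1
    have h7 : δ / 2 * ‖G (A x)‖ ≤ B + δ * M + 2 * M * (a * B + δ) := by nlinarith
    have h8 : ‖G (A x)‖ ≤ 2 / δ * (B + δ * M + 2 * M * (a * B + δ)) := by
      rw [div_mul_eq_mul_div, le_div_iff₀ hδ]; linarith
    linarith
  -- This needs no smallness of `s`: growth from `y₀` is added to the gradient inequality at `A x`.
  have hgap : σ / 2 * min δ s * s ≤ ⟪G (A x) - G y₀, A x - y₀⟫_ℝ := by
    have h2 := growth_of_strongConvexOn_closedBall hφ hδ hball hstrong (hG _ hy₀U) hx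
    have h3 := hφ.add_inner_le hx hy₀U (hG _ hx)
    rw [← neg_sub (A x) y₀, inner_neg_right] at h3
    rw [inner_sub_left]
    linarith
  have hsδ' : s ≤ δ' := by
    by_contra! hlt
    have h2 : δ' ≤ min δ s := le_min (min_le_left _ _) hlt.le
    have h3 : δ' * δ' ≤ min δ s * s := mul_le_mul h2 hlt.le hδ'0.le (hδ'0.le.trans h2)
    have h4 : ‖r‖ * (a * D) ≤ ‖r‖ * (a * N) := by gcongr
    have h5 := mul_le_mul_of_nonneg_left h3 hσ.le
    have h6 : 0 < σ * δ' ^ 2 := by positivity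
    linarith
  have hsδ : s ≤ δ := hsδ'.trans (min_le_left _ _)
  have hDL : D ≤ L * s := hlip _ (by rw [Metric.mem_closedBall, dist_eq_norm]; exact hsδ)
  have hz : IsSubgradient P (x + r) (-(LinearMap.adjoint A (G y₀) + c)) := by
    refine hstable _ _ hxr ?_
    have e : -r - (LinearMap.adjoint A (G (A x)) + c) - -(LinearMap.adjoint A (G y₀) + c)
      = -r - LinearMap.adjoint A (G (A x) - G y₀) := by rw [map_sub]; abel
    rw [e]
    have h2 := norm_sub_le (-r) (LinearMap.adjoint A (G (A x) - G y₀))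
    rw [norm_neg] at h2
    have h3 := hA' (G (A x) - G y₀)
    have h4 : a * D ≤ a * (L * s) := by gcongr
    have h5 : s ≤ ε₀ / (2 * a * (L + 1)) := hsδ'.trans (min_le_right _ _)
    rw [le_div_iff₀ (by positivity)] at h5
    have h6 : 0 ≤ a * s := by positivity
    linarith
  obtain ⟨x', hx', hAx', hdist⟩ := hhoff _ ((hmem _).1 hz)
  have hx's := (hmem x').2 hx'
  refine ⟨x', hx's, hAx', ?_⟩
  have hdist' : ‖x + r - x'‖ ≤ κ₀ * (s + a * ‖r‖) := by
    refine hdist.trans (mul_le_mul_of_nonneg_left ?_ hκ₀.le)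
    rw [map_add, add_sub_right_comm]
    exact (norm_add_le _ _).trans (by linarith)
  have hquad : σ / 2 * (s * s) ≤ ‖r‖ * (κ₀ * (s + a * ‖r‖)) + a * ‖r‖ * (L * s) := by
    have h2 := hgrowth x' hAx' hx's
    have h3 := neg_le_of_abs_le (abs_real_inner_le_norm r (x + r - x'))
    have h4 : ‖r‖ * ‖x + r - x'‖ ≤ ‖r‖ * (κ₀ * (s + a * ‖r‖)) := by gcongr
    have h5 : a * ‖r‖ * D ≤ a * ‖r‖ * (L * s) := by gcongr
    rw [min_eq_right hsδ] at hgap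
    linarith
  -- If `‖r‖ ≤ s`, one factor `‖r‖` of the quadratic term is replaced by `s`, and `s` cancels from
  -- `hquad`.
  have hsr : s ≤ (2 * C + 1) * ‖r‖ := by
    rcases le_total s ‖r‖ with h | h
    · have : 0 ≤ 2 * C * ‖r‖ := by positivity
      linarith
    · rcases hs0.eq_or_lt with h0 | h0
      · rw [← h0]; positivity
      have h2 : κ₀ * a * ‖r‖ * ‖r‖ ≤ κ₀ * a * ‖r‖ * s := by gcongr
      have h3 : σ / 2 * s * s ≤ (κ₀ + κ₀ * a + a * L) * ‖r‖ * s := by linarith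
      have h4 := le_of_mul_le_mul_right h3 h0
      have h5 : s ≤ C * ‖r‖ := by
        rw [hC, mul_assoc, div_mul_eq_mul_div, le_div_iff₀ hσ]; linarith
      have : 0 ≤ C * ‖r‖ := by positivity
      linarith
  have h2 : ‖x - x'‖ ≤ ‖x + r - x'‖ + ‖r‖ := by
    have e : x - x' = (x + r - x') - r := by abel
    rw [e]; exact norm_sub_le _ _
  have h3 := mul_le_mul_of_nonneg_left hsr hκ₀.le
  linarith

end ErrorBound

/-! ### Consequences of the structural assumption. -/

section Structural

variable {E T : Type*}
  [NormedAddCommGroup E] [InnerProductSpace ℝ E]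
  [NormedAddCommGroup T] [InnerProductSpace ℝ T] [FiniteDimensional ℝ T]
  {A : E →ₗ[ℝ] T} {c : E} {h : T → EReal} {f P : E → EReal}

namespace StructuralAssumption

variable (hs : StructuralAssumption A c h f P)

include hs

theorem hasGradientAt_h {y : T} (hy : y ∈ effDom h) :
    HasGradientAt (fun y => (h y).toReal) (grad h y) y :=
  ((hs.h_contDiff.differentiableOn one_ne_zero y hy).differentiableAt
    (hs.h_dom_open.mem_nhds hy)).hasGradientAt

theorem f_eq_coe {x : E} (hx : A x ∈ effDom h) :
    f x = (((h (A x)).toReal + ⟪c, x⟫_ℝ : ℝ) : EReal) := by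
  rw [hs.f_eq, EReal.coe_add, coe_toReal_of_mem_effDom hs.h_ne_bot hx]

theorem f_ne_bot (x : E) : f x ≠ ⊥ := by
  rw [hs.f_eq, Ne, EReal.add_eq_bot_iff]
  simp [hs.h_ne_bot]

theorem mem_effDom_of_f_ne_top {x : E} (hx : f x ≠ ⊤) : A x ∈ effDom h := by
  refine lt_of_le_of_ne le_top fun htop : h (A x) = ⊤ => hx ?_
  rw [hs.f_eq, htop, EReal.top_add_coe]

/-- The points of a real sublevel set of the objective have finite values. -/
theorem exists_coe_of_le {x : E} {ζ : ℝ} (hx : (f + P) x ≤ (ζ : EReal)) :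
    A x ∈ effDom h ∧ ∃ p : ℝ, P x = p ∧ (h (A x)).toReal + ⟪c, x⟫_ℝ + p ≤ ζ := by
  rw [Pi.add_apply] at hx
  have hlt := hx.trans_lt (EReal.coe_lt_top ζ)
  have hf : f x ≠ ⊤ := fun htop => by
    rw [htop, EReal.top_add_of_ne_bot (hs.P_ne_bot x)] at hlt
    exact lt_irrefl _ hlt
  have hP : P x ≠ ⊤ := fun htop => by
    rw [htop, EReal.add_top_of_ne_bot (hs.f_ne_bot x)] at hlt
    exact lt_irrefl _ hlt
  have hAx := hs.mem_effDom_of_f_ne_top hf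
  have hp := EReal.coe_toReal hP (hs.P_ne_bot x)
  refine ⟨hAx, _, hp.symm, ?_⟩
  rwa [hs.f_eq_coe hAx, ← hp, ← EReal.coe_add, EReal.coe_le_coe_iff] at hx

theorem exists_coe_of_mem_solutionSet {x : E} (hx : x ∈ solutionSet (f + P)) :
    A x ∈ effDom h ∧ ∃ p : ℝ, P x = p ∧
      (f + P) x = (((h (A x)).toReal + ⟪c, x⟫_ℝ + p : ℝ) : EReal) := by
  obtain ⟨ζ, hζ, -⟩ := EReal.lt_iff_exists_real_btwn.1 hx.1
  obtain ⟨hAx, p, hp, -⟩ := hs.exists_coe_of_le hζ.le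
  refine ⟨hAx, p, hp, ?_⟩
  rw [Pi.add_apply, hs.f_eq_coe hAx, hp, ← EReal.coe_add]

variable [FiniteDimensional ℝ E]

theorem eventually_mem_effDom {x : E} (hx : A x ∈ effDom h) : ∀ᶠ u in 𝓝 x, A u ∈ effDom h :=
  (A.continuous_of_finiteDimensional.tendsto x).eventually (hs.h_dom_open.mem_nhds hx)

theorem hasGradientAt_f {x : E} (hx : A x ∈ effDom h) :
    HasGradientAt (fun u => (f u).toReal) (LinearMap.adjoint A (grad h (A x)) + c) x := by
  have h1 : HasFDerivAt (fun u => (h (A u)).toReal + ⟪c, u⟫_ℝ)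
      ((InnerProductSpace.toDual ℝ T (grad h (A x))).comp (LinearMap.toContinuousLinearMap A)
        + innerSL ℝ c) x :=
    ((hs.hasGradientAt_h hx).hasFDerivAt.comp x
      (LinearMap.toContinuousLinearMap A).hasFDerivAt).add (innerSL ℝ c).hasFDerivAt
  have h2 : (InnerProductSpace.toDual ℝ T (grad h (A x))).comp (LinearMap.toContinuousLinearMap A)
        + innerSL ℝ c = InnerProductSpace.toDual ℝ E (LinearMap.adjoint A (grad h (A x)) + c) := by
    ext d
    simp [LinearMap.adjoint_inner_left]
  rw [hasGradientAt_iff_hasFDerivAt, ← h2]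
  refine h1.congr_of_eventuallyEq ?_
  filter_upwards [hs.eventually_mem_effDom hx] with u hu
  rw [hs.f_eq_coe hu, EReal.toReal_coe]

theorem grad_f {x : E} (hx : A x ∈ effDom h) :
    grad f x = LinearMap.adjoint A (grad h (A x)) + c :=
  (hs.hasGradientAt_f hx).gradient

/-- First-order optimality. -/
theorem isSubgradient_of_mem_solutionSet {x : E} (hx : x ∈ solutionSet (f + P)) :
    IsSubgradient P x (-(LinearMap.adjoint A (grad h (A x)) + c)) := by
  obtain ⟨hAx, p, hp, hF⟩ := hs.exists_coe_of_mem_solutionSet hx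
  refine ⟨p, hp, fun w t hw => ?_⟩
  set g := LinearMap.adjoint A (grad h (A x)) + c
  have hline : HasDerivAt (fun s : ℝ => x + s • (w - x)) (w - x) 0 := by
    simpa using ((hasDerivAt_id (0 : ℝ)).smul_const (w - x)).const_add x
  have h2 : HasFDerivAt (fun u => (f u).toReal) (InnerProductSpace.toDual ℝ E g)
      (x + (0 : ℝ) • (w - x)) := by
    rw [zero_smul, add_zero]; exact (hs.hasGradientAt_f hAx).hasFDerivAt
  have hφ := (h2.comp_hasDerivAt (0 : ℝ) hline).neg
  rw [InnerProductSpace.toDual_apply_apply] at hφ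
  have hev : ∀ᶠ s : ℝ in 𝓝[>] 0, A (x + s • (w - x)) ∈ effDom h := by
    have : Tendsto (fun s : ℝ => x + s • (w - x)) (𝓝[>] 0) (𝓝 (x + (0 : ℝ) • (w - x))) :=
      hline.continuousAt.tendsto.mono_left nhdsWithin_le_nhds
    rw [zero_smul, add_zero] at this
    exact this.eventually (hs.eventually_mem_effDom hAx)
  -- Along the segment, minimality of `x` and convexity of `P` bound the decrease of `f` by `s * (t
  -- - p)`.
  have := deriv_le_of_sub_le (C := t - p) (K := 0) hφ ?_
  · rw [inner_neg_left]; linarith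
  · filter_upwards [hev, Ioo_mem_nhdsGT (zero_lt_one' ℝ)] with s hs' ⟨hs0, hs1⟩
    have h1 : (s • (w, t) + (1 - s) • (x, p) : E × ℝ) ∈ epigraph P :=
      hs.P_convex (show (w, t) ∈ epigraph P from hw) (show (x, p) ∈ epigraph P from hp.le) hs0.le
        (sub_nonneg.2 hs1.le) (by ring)
    have e : s • w + (1 - s) • x = x + s • (w - x) := by module
    have h3 : P (x + s • (w - x)) ≤ ((s * t + (1 - s) * p : ℝ) : EReal) := by
      rw [← e]; exact h1
    have h4 := (hx.2 (x + s • (w - x))).trans (add_le_add_right h3 _)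
    rw [hF, hs.f_eq_coe hs', ← EReal.coe_add, EReal.coe_le_coe_iff] at h4
    simp only [Pi.neg_apply, Function.comp_apply, zero_smul, add_zero]
    rw [hs.f_eq_coe hs', hs.f_eq_coe hAx, EReal.toReal_coe, EReal.toReal_coe]
    linarith

/-- A point with the same image under `A` as a solution `x` and the same subgradient of `P` is a
solution. -/
theorem mem_solutionSet_of_isSubgradient {x x' : E} (hx : x ∈ solutionSet (f + P))
    (hA : A x' = A x)
    (hx' : IsSubgradient P x' (-(LinearMap.adjoint A (grad h (A x)) + c))) :
    x' ∈ solutionSet (f + P) := by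
  obtain ⟨hAx, p, hp, hF⟩ := hs.exists_coe_of_mem_solutionSet hx
  have hle : (f + P) x' ≤ (f + P) x := by
    have h1 := IsSubgradient.le hp hx'
    rw [inner_neg_left, inner_add_left, LinearMap.adjoint_inner_left, map_sub, hA, sub_self,
      inner_zero_right, zero_add, inner_sub_right] at h1
    rw [hF, Pi.add_apply, hs.f_eq_coe (by rwa [hA])]
    refine (add_le_add_right h1 _).trans ?_
    rw [← EReal.coe_add, EReal.coe_le_coe_iff, hA]
    linarith
  exact ⟨hle.trans_lt hx.1, fun z => hle.trans (hx.2 z)⟩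

/-- The growth of `h` above its linearization at `A x₀` provides the `min` term of
`exists_norm_le_of_isBounded_solutions`; the linear part of `f` is absorbed in the subgradient. -/
theorem exists_norm_sub_le_of_le (hpoly : IsPolyhedralFun P) {x₀ : E}
    (hx₀ : x₀ ∈ solutionSet (f + P)) (hbdd : Bornology.IsBounded (solutionSet (f + P)))
    {δ σ : ℝ} (hδ : 0 < δ) (hσ : 0 < σ) (hball : Metric.closedBall (A x₀) δ ⊆ effDom h)
    (hstrong : StrongConvexOn (Metric.closedBall (A x₀) δ) σ fun y => (h y).toReal) (ζ : ℝ) :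
    ∃ B : ℝ, ∀ x, (f + P) x ≤ (ζ : EReal) → ‖x - x₀‖ ≤ B := by
  obtain ⟨hAx₀, p₀, hp₀, -⟩ := hs.exists_coe_of_mem_solutionSet hx₀
  have hsub := hs.isSubgradient_of_mem_solutionSet hx₀
  obtain ⟨B, hB⟩ := exists_norm_le_of_isBounded_solutions (A := A)
    hpoly.isClosed hs.P_convex hs.P_ne_bot hp₀ hsub
    (hbdd.subset fun x hx => hs.mem_solutionSet_of_isSubgradient hx₀ hx.2 hx.1)
    (half_pos hσ) hδ (ζ - ((h (A x₀)).toReal + ⟪c, x₀⟫_ℝ + p₀))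
  refine ⟨B, fun x hx => ?_⟩
  obtain ⟨hAx, p, hp, hle⟩ := hs.exists_coe_of_le hx
  refine hB x p hp.le ?_
  have h1 := growth_of_strongConvexOn_closedBall (hs.h_convex.convexOn_toReal hs.h_ne_bot) hδ
    hball hstrong (hs.hasGradientAt_h hAx₀) hAx
  rw [inner_neg_left, inner_add_left, LinearMap.adjoint_inner_left, map_sub, inner_sub_right c]
  linarith

end StructuralAssumption

end Structural

end StructuredConvex

end

/-! ### The main theorem. -/

theorem mainTheorem8 {E T : Type*}
    [NormedAddCommGroup E] [InnerProductSpace ℝ E] [FiniteDimensional ℝ E]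
    [NormedAddCommGroup T] [InnerProductSpace ℝ T] [FiniteDimensional ℝ T]
    (A : E →ₗ[ℝ] T) (c : E) (h : T → EReal) (f P : E → EReal)
    (hstruct : StructuredConvex.StructuralAssumption A c h f P)
    (hsol : StructuredConvex.SolutionSetAssumption f P)
    (hpoly : StructuredConvex.IsPolyhedralFun P) :
    StructuredConvex.ProxErrorBound f P := by
  open StructuredConvex in
  intro ζ _
  obtain ⟨⟨x₀, hx₀⟩, hcompact⟩ := hsol
  have hAx₀ := (hstruct.exists_coe_of_mem_solutionSet hx₀).1
  obtain ⟨δ, hδ, hball⟩ :=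
    Metric.nhds_basis_closedBall.mem_iff.1 (hstruct.h_dom_open.mem_nhds hAx₀)
  have hVc := isCompact_closedBall (A x₀) δ
  have hVconv := convex_closedBall (A x₀) δ
  obtain ⟨σ, hσ, hstrong⟩ := hstruct.h_strong _ hVc hVconv hball
  obtain ⟨L, hL⟩ := hstruct.h_lipschitz _ hVc hVconv hball
  obtain ⟨B, hB⟩ :=
    hstruct.exists_norm_sub_le_of_le hpoly hx₀ hcompact.isBounded hδ hσ hball hstrong ζ
  have hsub := hstruct.isSubgradient_of_mem_solutionSet hx₀
  -- The radius is taken as `|B|`, since `B` comes without a sign.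
  obtain ⟨κ, hκ, ε, hε, hbound⟩ := exists_error_bound_of_isSubgradient
    (hstruct.h_convex.convexOn_toReal hstruct.h_ne_bot) (fun y hy => hstruct.hasGradientAt_h hy)
    hpoly hstruct.P_ne_bot hδ hσ L.2 hball hstrong
    (fun y hy => hL.norm_sub_le hy (Metric.mem_closedBall_self hδ.le)) hsub (abs_nonneg B)
  refine ⟨κ, hκ, ε, hε, fun x hx hr => ?_⟩
  have hAx := (hstruct.exists_coe_of_le hx).1
  have hprox := isSubgradient_prox hpoly.isClosed hstruct.P_ne_bot hstruct.P_convex hsub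
    (x - grad f x)
  have e1 : prox P (x - grad f x) = x + residual f P x := by
    rw [StructuredConvex.residual]; abel
  have e2 : x - grad f x - (x + residual f P x)
      = -residual f P x - (LinearMap.adjoint A (grad h (A x)) + c) := by
    rw [hstruct.grad_f hAx]; abel
  rw [e1, e2] at hprox
  obtain ⟨x', hx', hAx', hle⟩ := hbound x _ hAx ((hB x hx).trans (le_abs_self B)) hr hprox
  refine (Metric.infDist_le_dist_of_mem
    (hstruct.mem_solutionSet_of_isSubgradient hx₀ hAx' hx')).trans ?_
  rwa [dist_eq_norm]
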